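/- \textbf{Fractional monodromy of the truncated $p:-q$ resonance.} Let $p,q$ be coprime positive integers with $p+q\ge 3$, let $\mu\in\mathbb R\setminus\{0\}$, and let $a,b$ be any integers with $bp+aq=1$. On $T^*\mathbb R^2\cong\mathbb C^2$, $z_j=(p_j+\mathrm i q_j)/\sqrt2$, consider the integrable Hamiltonian system with momentum map $F=(H_2,\mu\,\Delta H)$, \[ H_2=p|z_1|^2-q|z_2|^2,\qquad \Delta H=\operatorname{Re}(z_1^q z_2^p), \] Hamiltonian $H_2+\mu\,\Delta H$, and values $(h,\delta)$ of $F$. Put $I_1=H_2$, so $I_1=h$. On the fibre over $(h,\delta)$, $\delta\neq0$, let $\psi_2=\arg(z_1^qz_2^p)$ and let $J_2=a|z_1|^2+b|z_2|^2$ be its conjugate momentum; define the second action \[ I_2(h,\delta)=\frac1{2\pi}\oint J_2\,d\psi_2 , \] the integral being taken once along the (unbounded) reduced orbit in the direction of the motion. The lift of the reduced orbit along which $b\arg z_1-a\arg z_2=0$, namely $\arg z_1=a\psi_2$, $\arg z_2=b\psi_2$, lies in the fibre $F=(h,\delta)$. All integrals here converge absolutely, and \[ I_2=\frac{p+q}{4\pi}\,\delta\,T-I_1W,\qquad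 T=\oint\frac{dx}{w},\qquad W=\frac{qb}{4\pi}\,\delta\oint\frac{dx}{x\,w}-\frac{ap}{4\pi}\,\delta\oint\frac{dx}{\pi_2(x)\,w}, \] where $\pi_2(x)=(px-h)/q$, $w^2=\mu^2q^2x^q\pi_2(x)^p-q^2\delta^2$, and $\oint$ is twice the integral, with $w>0$, over the half-line of all $x>0$ with $\pi_2(x)>0$ and $w^2>0$. Let $(r,\alpha)$, $r>0$, $\alpha\in\mathbb R$, be coordinates on the universal covering of the punctured $(h,\delta)$-plane, $(h,\delta)=(r\cos\alpha,r\sin\alpha)$. Let $r_0>0$ and $k\in\mathbb Z$. Then there is exactly one continuous function $\tilde I_2$ on $\{0<r<r_0\}$ which equals $I_2$ in the sector $k\pi<\alpha<(k+1)\pi$ and which, in each sector $n\pi<\alpha<(n+1)\pi$, $n\in\mathbb Z$, is of the form $I_2+c_nI_1+d_n$ with constants $c_n,d_n\in\mathbb R$. After one anticlockwise loop around the origin, $(r,\alpha)\mapsto(r,\alpha+2\pi)$, the actions $(I_1,\tilde I_2)$ change to $(I_1',\tilde I_2')$ with \[ \begin{pmatrix}I_1'\\ \tilde I_2'\end{pmatrix}=\begin{pmatrix}1&0\\-\frac1{pq}&1\end{pmatrix}\begin{pmatrix}I_1\\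 \tilde I_2\end{pmatrix}, \] at every point of the covering with $0<r<r_0$. This matrix does not depend on $a,b$ and does not have integer entries: the monodromy is fractional. -/

import Mathlib

open Real Set MeasureTheory

noncomputable section

namespace Resonance

/-! ### The truncated `p : -q` resonant system

A point of `T*ℝ²` with coordinates `(p₁, q₁, p₂, q₂)` is written `(z₁, z₂) ∈ ℂ²`, where
`z_j = (p_j + i q_j) / √2`, so that `A_j = |z_j|²` and `φ_j = arg z_j` are canonical polar
coordinates. -/

/-- The quadratic part `H₂ = p |z₁|² - q |z₂|²` of the Hamiltonian. -/
def quadraticPart (p q : ℕ) (z : ℂ × ℂ) : ℝ :=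
  (p : ℝ) * ‖z.1‖ ^ 2 - (q : ℝ) * ‖z.2‖ ^ 2

/-- The non-linear (resonant) part `μ Re (z₁ ^ q z₂ ^ p)` of the Hamiltonian. -/
def resonantPart (p q : ℕ) (μ : ℝ) (z : ℂ × ℂ) : ℝ :=
  μ * (z.1 ^ q * z.2 ^ p).re

/-- The momentum map of the integrable system. The Hamiltonian is the sum of its two components,
and its values `(h, δ)` form the plane of the bifurcation diagram. -/
def momentumMap (p q : ℕ) (μ : ℝ) (z : ℂ × ℂ) : ℝ × ℝ :=
  (quadraticPart p q z, resonantPart p q μ z)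

/-- On `H₂ = h`, the value of `π₂ = |z₂|²` at a point where `π₁ = |z₁|² = x`. -/
def pi2 (p q : ℕ) (h x : ℝ) : ℝ := ((p : ℝ) * x - h) / (q : ℝ)

/-! ### Period and rotation number -/

/-- The polynomial `Q(x) = μ² q ^ (2 - p) x ^ q (p x - h) ^ p - (q δ)²`; along the reduced motion
`(dπ₁/dt)² = Q(π₁)`. -/
def curvePoly (p q : ℕ) (μ h δ x : ℝ) : ℝ :=
  (μ * (q : ℝ)) ^ 2 * (x ^ q * pi2 p q h x ^ p) - ((q : ℝ) * δ) ^ 2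

/-- The values of `π₁` on the reduced orbit (without its turning point): a half-line. -/
def orbitRange (p q : ℕ) (μ h δ : ℝ) : Set ℝ :=
  {x | 0 < x ∧ 0 < pi2 p q h x ∧ 0 < curvePoly p q μ h δ x}

/-- The integral `∮ f(π₁) dπ₁ / w`, `w² = Q(π₁)`, along the reduced orbit, which comes from
infinity to the turning point (with `w = -√Q`) and returns to infinity (with `w = √Q`). -/
def orbitIntegral (p q : ℕ) (μ h δ : ℝ) (f : ℝ → ℝ) : ℝ :=
  2 * ∫ x in orbitRange p q μ h δ, f x / √(curvePoly p q μ h δ x)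

/-- The reduced period `T = ∮ dπ₁ / w`. -/
def period (p q : ℕ) (μ h δ : ℝ) : ℝ :=
  orbitIntegral p q μ h δ (fun _ => 1)

/-- `W₁ = (q b / 4π) δ ∮ dπ₁ / (π₁ w)`. -/
def rotation1 (p q : ℕ) (μ : ℝ) (b : ℤ) (h δ : ℝ) : ℝ :=
  (q : ℝ) * (b : ℝ) / (4 * π) * δ * orbitIntegral p q μ h δ (fun x => 1 / x)

/-- `W₂ = -(a p / 4π) δ ∮ dπ₁ / (π₂ w)`. -/
def rotation2 (p q : ℕ) (μ : ℝ) (a : ℤ) (h δ : ℝ) : ℝ :=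
  -((a : ℝ) * (p : ℝ) / (4 * π)) * δ * orbitIntegral p q μ h δ (fun x => 1 / pi2 p q h x)

/-- `W = W₁ + W₂`. -/
def rotation (p q : ℕ) (μ : ℝ) (a b : ℤ) (h δ : ℝ) : ℝ :=
  rotation1 p q μ b h δ + rotation2 p q μ a h δ

/-! ### The actions

With `bp + aq = 1`, the functions `J₁ = H₂`, `J₂ = a |z₁|² + b |z₂|²`, `ψ₁ = b φ₁ - a φ₂`,
`ψ₂ = q φ₁ + p φ₂ = arg (z₁ ^ q z₂ ^ p)` are canonical coordinates:
`A₁ dφ₁ + A₂ dφ₂ = J₁ dψ₁ + J₂ dψ₂`. -/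

/-- The value of `π₁` on the fibre over `(h, δ)` at resonant angle `ψ₂ = ψ`: for `δ μ cos ψ > 0`,
the solution `x` of `μ √(x ^ q π₂ ^ p) cos ψ = δ` with `x ≥ 0`, `π₂ ≥ 0`, where the left hand
side is strictly monotone in `x`. -/
def orbitPi1 (p q : ℕ) (μ h δ ψ : ℝ) : ℝ :=
  sInf {x | 0 ≤ x ∧ 0 ≤ pi2 p q h x ∧ |δ| ≤ |μ * cos ψ| * √(x ^ q * pi2 p q h x ^ p)}

/-- The values taken by the resonant angle `ψ₂` (modulo `2π`) on the fibre over `(h, δ)`. -/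
def angleRange (μ δ : ℝ) : Set ℝ :=
  {ψ | -(π / 2) < ψ ∧ ψ < 3 * π / 2 ∧ 0 < δ * (μ * cos ψ)}

/-- The lift to the fibre of the reduced orbit along `ψ₁ = 0`, where `φ₁ = a ψ₂`, `φ₂ = b ψ₂`. -/
def cycle (p q : ℕ) (μ : ℝ) (a b : ℤ) (h δ ψ : ℝ) : ℂ × ℂ :=
  ((√(orbitPi1 p q μ h δ ψ) : ℂ) * Complex.exp (((a : ℝ) * ψ : ℝ) * Complex.I),
   (√(pi2 p q h (orbitPi1 p q μ h δ ψ)) : ℂ) * Complex.exp (((b : ℝ) * ψ : ℝ) * Complex.I))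

/-- The momentum `J₂ = a |z₁|² + b |z₂|²` conjugate to the resonant angle `ψ₂`. -/
def momentum2 (a b : ℤ) (z : ℂ × ℂ) : ℝ := (a : ℝ) * ‖z.1‖ ^ 2 + (b : ℝ) * ‖z.2‖ ^ 2

/-- The non-trivial action `I₂ = (1 / 2π) ∮ J₂ dψ₂` at a value `(h, δ)`, `δ ≠ 0`. The orbit is
oriented by the motion, `dψ₂/dt = ∂H/∂J₂` having the sign of `δ`. -/
def action2 (p q : ℕ) (μ : ℝ) (a b : ℤ) (h δ : ℝ) : ℝ :=
  SignType.sign δ * (1 / (2 * π)) *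
    ∫ ψ in angleRange μ δ, momentum2 a b (cycle p q μ a b h δ ψ)

/-! ### Continuation around the origin

`(r, α)`, `r > 0`, `α ∈ ℝ`, are coordinates on the universal covering of the punctured
`(h, δ)`-plane, with covering map `(r, α) ↦ (h, δ) = (r cos α, r sin α)`. One anticlockwise loop
around the origin starting at `(r, α)` ends, after lifting, at `(r, α + 2π)`. -/

/-- The action `I₁ = H₂` on the covering. -/
def coverAction1 (x : ℝ × ℝ) : ℝ := x.1 * cos x.2

/-- The covering of the punctured disc of radius `r₀` in the `(h, δ)`-plane. -/
def coverDomain (r₀ : ℝ) : Set (ℝ × ℝ) := Ioo 0 r₀ ×ˢ univ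

/-- `I` continues the action `I₂` around the origin, starting in the sector
`kπ < α < (k + 1)π`: it is continuous, including at the half-lines `δ = 0`; it coincides with
`I₂` in the starting sector; and in every sector it is again a second action, i.e. it differs
from `I₂` by a constant multiple of `I₁` and a constant. -/
structure IsContinuation (p q : ℕ) (μ : ℝ) (a b : ℤ) (r₀ : ℝ) (k : ℤ) (I : ℝ × ℝ → ℝ) :
    Prop where
  continuousOn : ContinuousOn I (coverDomain r₀)
  start : ∀ r ∈ Ioo 0 r₀, ∀ α ∈ Ioo ((k : ℝ) * π) (((k : ℝ) + 1) * π),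
    I (r, α) = action2 p q μ a b (r * cos α) (r * sin α)
  isAction : ∀ n : ℤ, ∃ c d : ℝ,
    ∀ r ∈ Ioo 0 r₀, ∀ α ∈ Ioo ((n : ℝ) * π) (((n : ℝ) + 1) * π),
      I (r, α) = action2 p q μ a b (r * cos α) (r * sin α) + c * coverAction1 (r, α) + d

/-- The monodromy matrix. -/
def monodromyMatrix (p q : ℕ) : Matrix (Fin 2) (Fin 2) ℝ :=
  !![1, 0; -(1 / ((p : ℝ) * (q : ℝ))), 1]

end Resonance

end

noncomputable section

namespace Resonance

open Filter Topology

variable {p q : ℕ} {h δ m μ x y ψ : ℝ}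

/-- The product `π₁ ^ q π₂ ^ p` on `H₂ = h` as a function of `π₁ = x`. -/
def resProduct (p q : ℕ) (h x : ℝ) : ℝ := x ^ q * pi2 p q h x ^ p

/-- The points `x` of the reduced phase space `H₂ = h` with `|δ| ≤ m √(π₁ ^ q π₂ ^ p)`. -/
def aboveSet (p q : ℕ) (h δ m : ℝ) : Set ℝ :=
  {x | 0 ≤ x ∧ 0 ≤ pi2 p q h x ∧ |δ| ≤ m * √(resProduct p q h x)}

/-- The smallest value of `π₁` on `H₂ = h` with `|δ| ≤ m √(π₁ ^ q π₂ ^ p)`. -/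
def turningPoint (p q : ℕ) (h δ m : ℝ) : ℝ := sInf (aboveSet p q h δ m)

theorem orbitPi1_eq : orbitPi1 p q μ h δ ψ = turningPoint p q h δ |μ * cos ψ| := rfl

theorem pi2_lt_pi2 (hp : 0 < p) (hq : 0 < q) (hxy : x < y) : pi2 p q h x < pi2 p q h y := by
  have hp' : (0 : ℝ) < p := by exact_mod_cast hp
  have hq' : (0 : ℝ) < q := by exact_mod_cast hq
  unfold pi2
  gcongr

theorem continuous_pi2 : Continuous fun z : ℝ × ℝ => pi2 p q z.1 z.2 := by
  unfold pi2; fun_prop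

theorem continuous_resProduct : Continuous fun z : ℝ × ℝ => resProduct p q z.1 z.2 := by
  have := continuous_pi2 (p := p) (q := q)
  unfold resProduct; fun_prop

theorem resProduct_lt_resProduct (hp : 0 < p) (hq : 0 < q) (hx : 0 ≤ x) (hπ : 0 ≤ pi2 p q h x)
    (hxy : x < y) : resProduct p q h x < resProduct p q h y :=
  mul_lt_mul'' (pow_lt_pow_left₀ hxy hx hq.ne')
    (pow_lt_pow_left₀ (pi2_lt_pi2 hp hq hxy) hπ hp.ne') (by positivity) (by positivity)

theorem resProduct_nonneg (hx : 0 ≤ x) (hπ : 0 ≤ pi2 p q h x) : 0 ≤ resProduct p q h x := by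
  unfold resProduct; positivity

theorem resProduct_pos (hx : 0 < x) (hπ : 0 < pi2 p q h x) : 0 < resProduct p q h x := by
  unfold resProduct; positivity

theorem half_le_pi2 (hp : 0 < p) (hq : 0 < q) (hx : 2 * |h| / p ≤ x) :
    p / (2 * q) * x ≤ pi2 p q h x := by
  have hp' : (0 : ℝ) < p := by exact_mod_cast hp
  have hq' : (0 : ℝ) < q := by exact_mod_cast hq
  rw [div_le_iff₀ hp'] at hx
  have := le_abs_self h
  rw [pi2, div_mul_eq_mul_div, div_le_div_iff₀ (by positivity) hq']
  nlinarith

theorem cube_le_resProduct (hp : 0 < p) (hq : 0 < q) (hord : 3 ≤ p + q) (h1 : 1 ≤ x)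
    (hx : 2 * |h| / p ≤ x) : (p / (2 * q) : ℝ) ^ p * x ^ 3 ≤ resProduct p q h x := by
  have h0 : 0 ≤ x := by linarith
  calc (p / (2 * q) : ℝ) ^ p * x ^ 3 ≤ (p / (2 * q) : ℝ) ^ p * x ^ (p + q) := by
        gcongr
    _ = x ^ q * (p / (2 * q) * x) ^ p := by rw [mul_pow, pow_add]; ring
    _ ≤ x ^ q * pi2 p q h x ^ p := by gcongr; exact half_le_pi2 hp hq hx

/-- An explicit point of `aboveSet`. -/
def turningBound (p q : ℕ) (h δ m : ℝ) : ℝ :=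
  1 + 2 * |h| / p + (δ ^ 2 / (m ^ 2 * (p / (2 * q) : ℝ) ^ p)) ^ (1 / 3 : ℝ)

theorem turningBound_mem (hp : 0 < p) (hq : 0 < q) (hord : 3 ≤ p + q) (hm : 0 < m) :
    turningBound p q h δ m ∈ aboveSet p q h δ m := by
  have hp' : (0 : ℝ) < p := by exact_mod_cast hp
  have hq' : (0 : ℝ) < q := by exact_mod_cast hq
  set κ : ℝ := (p / (2 * q) : ℝ) ^ p with hκ
  have hκ0 : 0 < κ := by positivity
  set t : ℝ := δ ^ 2 / (m ^ 2 * κ) with ht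
  have ht0 : 0 ≤ t := by positivity
  have hB : turningBound p q h δ m = 1 + 2 * |h| / p + t ^ (1 / 3 : ℝ) := rfl
  have hc0 : 0 ≤ t ^ (1 / 3 : ℝ) := by positivity
  have hc : (t ^ (1 / 3 : ℝ)) ^ 3 = t := by
    rw [← Real.rpow_natCast, ← Real.rpow_mul ht0]; norm_num
  have hh : 0 ≤ 2 * |h| / p := by positivity
  set B := turningBound p q h δ m with hBdef
  have h1 : 1 ≤ B := by rw [hB]; linarith
  have h2 : 2 * |h| / p ≤ B := by rw [hB]; linarith
  have h3 : t ≤ B ^ 3 := by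
    rw [← hc]; gcongr; rw [hB]; linarith
  have h4 := cube_le_resProduct hp hq hord h1 h2
  refine ⟨by linarith, le_trans (by positivity) (half_le_pi2 hp hq h2), ?_⟩
  rw [← div_le_iff₀' hm]
  apply Real.le_sqrt_of_sq_le
  refine le_trans ?_ h4
  rw [div_pow, sq_abs]
  calc δ ^ 2 / m ^ 2 = κ * t := by rw [ht]; field_simp
    _ ≤ κ * B ^ 3 := by gcongr

theorem bddBelow_aboveSet : BddBelow (aboveSet p q h δ m) := ⟨0, fun _ hx => hx.1⟩

theorem isClosed_aboveSet : IsClosed (aboveSet p q h δ m) := by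
  have h1 : Continuous fun x => pi2 p q h x :=
    (continuous_pi2 (p := p) (q := q)).comp (by fun_prop : Continuous fun x : ℝ => (h, x))
  have h2 : Continuous fun x => resProduct p q h x :=
    (continuous_resProduct (p := p) (q := q)).comp (by fun_prop : Continuous fun x : ℝ => (h, x))
  exact (isClosed_le continuous_const continuous_id).inter
    ((isClosed_le continuous_const h1).inter (isClosed_le continuous_const (continuous_const.mul h2.sqrt)))

theorem turningPoint_mem (hp : 0 < p) (hq : 0 < q) (hord : 3 ≤ p + q) (hm : 0 < m) :
    turningPoint p q h δ m ∈ aboveSet p q h δ m :=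
  isClosed_aboveSet.csInf_mem ⟨_, turningBound_mem hp hq hord hm⟩ bddBelow_aboveSet

theorem turningPoint_le (hx : x ∈ aboveSet p q h δ m) : turningPoint p q h δ m ≤ x :=
  csInf_le bddBelow_aboveSet hx

theorem turningPoint_nonneg : 0 ≤ turningPoint p q h δ m :=
  Real.sInf_nonneg fun _ hx => hx.1

theorem turningPoint_le_bound (hp : 0 < p) (hq : 0 < q) (hord : 3 ≤ p + q) (hm : 0 < m) :
    turningPoint p q h δ m ≤ turningBound p q h δ m :=
  turningPoint_le (turningBound_mem hp hq hord hm)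

/-- Strict inequalities hold to the right of the turning point. -/
theorem strict_of_turningPoint_lt (hp : 0 < p) (hq : 0 < q) (hord : 3 ≤ p + q) (hm : 0 < m)
    (hx : turningPoint p q h δ m < x) :
    0 < x ∧ 0 < pi2 p q h x ∧ |δ| < m * √(resProduct p q h x) := by
  obtain ⟨h1, h2, h3⟩ := turningPoint_mem (h := h) (δ := δ) hp hq hord hm
  refine ⟨h1.trans_lt hx, h2.trans_lt (pi2_lt_pi2 hp hq hx), h3.trans_lt ?_⟩
  have := resProduct_lt_resProduct hp hq h1 h2 hx
  exact mul_lt_mul_of_pos_left (Real.sqrt_lt_sqrt (resProduct_nonneg h1 h2) this) hm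

theorem pos_of_mem_aboveSet (hp : 0 < p) (hq : 0 < q) (hδ : δ ≠ 0)
    (hx : x ∈ aboveSet p q h δ m) : 0 < x ∧ 0 < pi2 p q h x := by
  obtain ⟨h1, h2, h3⟩ := hx
  have hδ' : 0 < |δ| := abs_pos.2 hδ
  constructor
  · refine h1.lt_of_ne' fun h0 => ?_
    simp [h0, resProduct, hq.ne'] at h3
    exact hδ h3
  · refine h2.lt_of_ne' fun h0 => ?_
    simp [h0, resProduct, hp.ne'] at h3
    exact hδ h3

theorem isOpen_strict (p q : ℕ) :
    IsOpen {z : (ℝ × ℝ × ℝ) × ℝ | 0 < z.2 ∧ 0 < pi2 p q z.1.1 z.2 ∧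
      |z.1.2.1| < z.1.2.2 * √(resProduct p q z.1.1 z.2)} := by
  have h1 : Continuous fun z : (ℝ × ℝ × ℝ) × ℝ => pi2 p q z.1.1 z.2 :=
    (continuous_pi2 (p := p) (q := q)).comp
      (by fun_prop : Continuous fun z : (ℝ × ℝ × ℝ) × ℝ => (z.1.1, z.2))
  have h2 : Continuous fun z : (ℝ × ℝ × ℝ) × ℝ => resProduct p q z.1.1 z.2 :=
    (continuous_resProduct (p := p) (q := q)).comp
      (by fun_prop : Continuous fun z : (ℝ × ℝ × ℝ) × ℝ => (z.1.1, z.2))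
  exact (isOpen_lt continuous_const continuous_snd).inter
    ((isOpen_lt continuous_const h1).inter (isOpen_lt (continuous_fst.snd.fst.abs)
      (continuous_fst.snd.snd.mul h2.sqrt)))

theorem isClosed_above (p q : ℕ) :
    IsClosed {z : (ℝ × ℝ × ℝ) × ℝ | z.2 ∈ aboveSet p q z.1.1 z.1.2.1 z.1.2.2} := by
  have h1 : Continuous fun z : (ℝ × ℝ × ℝ) × ℝ => pi2 p q z.1.1 z.2 :=
    (continuous_pi2 (p := p) (q := q)).comp
      (by fun_prop : Continuous fun z : (ℝ × ℝ × ℝ) × ℝ => (z.1.1, z.2))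
  have h2 : Continuous fun z : (ℝ × ℝ × ℝ) × ℝ => resProduct p q z.1.1 z.2 :=
    (continuous_resProduct (p := p) (q := q)).comp
      (by fun_prop : Continuous fun z : (ℝ × ℝ × ℝ) × ℝ => (z.1.1, z.2))
  exact (isClosed_le continuous_const continuous_snd).inter
    ((isClosed_le continuous_const h1).inter (isClosed_le (continuous_fst.snd.fst.abs)
      (continuous_fst.snd.snd.mul h2.sqrt)))

theorem abs_eq_of_turningPoint (hp : 0 < p) (hq : 0 < q) (hord : 3 ≤ p + q) (hm : 0 < m)
    (hδ : δ ≠ 0) : m * √(resProduct p q h (turningPoint p q h δ m)) = |δ| := by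
  have hmem := turningPoint_mem (h := h) (δ := δ) hp hq hord hm
  obtain ⟨h1, h2⟩ := pos_of_mem_aboveSet hp hq hδ hmem
  refine (hmem.2.2.eq_or_lt.resolve_right fun hlt => ?_).symm
  have hopen : IsOpen {y | 0 < y ∧ 0 < pi2 p q h y ∧ |δ| < m * √(resProduct p q h y)} :=
    (isOpen_strict p q).preimage (by fun_prop : Continuous fun y : ℝ => ((h, δ, m), y))
  obtain ⟨l, hl, hsub⟩ := exists_Ioc_subset_of_mem_nhds (hopen.mem_nhds ⟨h1, h2, hlt⟩) ⟨0, h1⟩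
  obtain ⟨y, hly, hyt⟩ := exists_between hl
  obtain ⟨h3, h4, h5⟩ := hsub ⟨hly, hyt.le⟩
  exact absurd (turningPoint_le ⟨h3.le, h4.le, h5.le⟩) (not_le.2 hyt)

theorem turningPoint_eq (hp : 0 < p) (hq : 0 < q) (hord : 3 ≤ p + q) (hm : 0 < m)
    (hx : 0 ≤ x) (hπ : 0 ≤ pi2 p q h x) (he : m * √(resProduct p q h x) = |δ|) :
    turningPoint p q h δ m = x := by
  refine (turningPoint_le ⟨hx, hπ, he.ge⟩).eq_or_lt.resolve_right fun hlt => ?_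
  exact absurd he (strict_of_turningPoint_lt hp hq hord hm hlt).2.2.ne'

theorem continuousAt_turningPoint (hp : 0 < p) (hq : 0 < q) (hord : 3 ≤ p + q) (hm : 0 < m) :
    ContinuousAt (fun z : ℝ × ℝ × ℝ => turningPoint p q z.1 z.2.1 z.2.2) (h, δ, m) := by
  have hpos : ∀ᶠ z : ℝ × ℝ × ℝ in 𝓝 (h, δ, m), 0 < z.2.2 :=
    (isOpen_lt continuous_const (by fun_prop : Continuous fun z : ℝ × ℝ × ℝ => z.2.2)).mem_nhds hm
  refine tendsto_order.2 ⟨fun l hl => ?_, fun u hu => ?_⟩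
  · have hopen := (isClosed_above p q).isOpen_compl.preimage
      (by fun_prop : Continuous fun z : ℝ × ℝ × ℝ => (z, l))
    have hmem : l ∉ aboveSet p q h δ m := fun hl' => absurd (turningPoint_le hl') (not_le.2 hl)
    filter_upwards [hpos, hopen.mem_nhds (x := (h, δ, m)) hmem] with z hz hz'
    by_contra! hle
    refine hz' ?_
    rcases hle.eq_or_lt with heq | hlt
    · exact heq ▸ turningPoint_mem hp hq hord hz
    · obtain ⟨h1, h2, h3⟩ := strict_of_turningPoint_lt hp hq hord hz hlt
      exact ⟨h1.le, h2.le, h3.le⟩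
  · obtain ⟨v, hv, hvu⟩ := exists_between hu
    have hopen := (isOpen_strict p q).preimage
      (by fun_prop : Continuous fun z : ℝ × ℝ × ℝ => (z, v))
    filter_upwards [hopen.mem_nhds (x := (h, δ, m))
      (strict_of_turningPoint_lt hp hq hord hm hv)] with z hz
    exact (turningPoint_le ⟨hz.1.le, hz.2.1.le, hz.2.2.le⟩).trans_lt hvu

theorem turningPoint_zero (hp : 0 < p) (hq : 0 < q) (hm : 0 < m) :
    turningPoint p q h 0 m = max 0 (h / p) := by
  have hp' : (0 : ℝ) < p := by exact_mod_cast hp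
  have hq' : (0 : ℝ) < q := by exact_mod_cast hq
  have : aboveSet p q h 0 m = Ici (max 0 (h / p)) := by
    ext x
    have : 0 ≤ m * √(resProduct p q h x) := by positivity
    simp [aboveSet, this, pi2, le_div_iff₀ hq', div_le_iff₀ hp', mul_comm]
  rw [turningPoint, this, csInf_Ici]

theorem cos_pos_of_mem (hψ : ψ ∈ Ioo (-(π / 2)) (π / 2)) : 0 < cos ψ :=
  Real.cos_pos_of_mem_Ioo hψ

theorem abs_mul_cos_pos (hμ : μ ≠ 0) (hψ : ψ ∈ Ioo (-(π / 2)) (π / 2)) : 0 < |μ * cos ψ| :=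
  abs_pos.2 (mul_ne_zero hμ (cos_pos_of_mem hψ).ne')

theorem angleRange_of_pos (hδ : 0 < δ * μ) : angleRange μ δ = Ioo (-(π / 2)) (π / 2) := by
  have hπ := Real.pi_pos
  ext ψ
  simp only [angleRange, mem_ofPred_eq, mem_Ioo, ← mul_assoc, mul_pos_iff_of_pos_left hδ]
  refine ⟨fun ⟨h1, h2, h3⟩ => ⟨h1, ?_⟩, fun hψ => ⟨hψ.1, by linarith [hψ.2], cos_pos_of_mem hψ⟩⟩
  by_contra! hle
  exact absurd (Real.cos_nonpos_of_pi_div_two_le_of_le hle (by linarith)) (not_le.2 h3)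

theorem angleRange_of_neg (hδ : δ * μ < 0) :
    angleRange μ δ = (fun ψ => ψ - π) ⁻¹' Ioo (-(π / 2)) (π / 2) := by
  have hπ := Real.pi_pos
  ext ψ
  simp only [angleRange, mem_ofPred_eq, mem_preimage, mem_Ioo, ← mul_assoc]
  refine ⟨fun ⟨h1, h2, h3⟩ => ⟨?_, by linarith⟩, fun hψ => ⟨by linarith [hψ.1],
    by linarith [hψ.2], ?_⟩⟩
  · by_contra! hle
    have := Real.cos_nonneg_of_mem_Icc (x := ψ) ⟨h1.le, by linarith⟩
    nlinarith
  · have := cos_pos_of_mem (ψ := ψ - π) hψ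
    rw [Real.cos_sub_pi] at this
    nlinarith

theorem measurableSet_angleRange (hμ : μ ≠ 0) (hδ : δ ≠ 0) : MeasurableSet (angleRange μ δ) := by
  rcases (mul_ne_zero hδ hμ).lt_or_gt with hlt | hgt
  · rw [angleRange_of_neg hlt]
    exact (measurable_id.sub_const π) measurableSet_Ioo
  · rw [angleRange_of_pos hgt]
    exact measurableSet_Ioo

theorem cos_sub_pi_abs : |μ * cos (ψ - π)| = |μ * cos ψ| := by
  rw [Real.cos_sub_pi, mul_neg, abs_neg]

theorem setIntegral_angleRange (hμ : μ ≠ 0) (hδ : δ ≠ 0) (F : ℝ → ℝ) :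
    ∫ ψ in angleRange μ δ, F |μ * cos ψ| = ∫ ψ in Ioo (-(π / 2)) (π / 2), F |μ * cos ψ| := by
  rcases (mul_ne_zero hδ hμ).lt_or_gt with hlt | hgt
  · have := (measurePreserving_sub_right volume π).setIntegral_preimage_emb
      (measurableEmbedding_subRight π) (fun ψ => F |μ * cos ψ|) (Ioo (-(π / 2)) (π / 2))
    simp only [cos_sub_pi_abs] at this
    rw [angleRange_of_neg hlt, this]
  · rw [angleRange_of_pos hgt]

theorem integrableOn_angleRange_iff (hμ : μ ≠ 0) (hδ : δ ≠ 0) (F : ℝ → ℝ) :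
    IntegrableOn (fun ψ => F |μ * cos ψ|) (angleRange μ δ) ↔
      IntegrableOn (fun ψ => F |μ * cos ψ|) (Ioo (-(π / 2)) (π / 2)) := by
  rcases (mul_ne_zero hδ hμ).lt_or_gt with hlt | hgt
  · have := (measurePreserving_sub_right volume π).integrableOn_comp_preimage
      (measurableEmbedding_subRight π) (f := fun ψ => F |μ * cos ψ|)
      (s := Ioo (-(π / 2)) (π / 2))
    simp only [Function.comp_def, cos_sub_pi_abs] at this
    rw [angleRange_of_neg hlt, this]
  · rw [angleRange_of_pos hgt]

theorem integrableOn_cos_rpow :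
    IntegrableOn (fun ψ => cos ψ ^ (-(2 / 3) : ℝ)) (Ioo (-(π / 2)) (π / 2)) := by
  have hπ := Real.pi_pos
  have hle : -(π / 2) ≤ π / 2 := by linarith
  have h0 : IntervalIntegrable (fun x : ℝ => x ^ (-(2 / 3) : ℝ)) volume 0 π :=
    intervalIntegral.intervalIntegrable_rpow' (by norm_num)
  have h1 := (h0.comp_sub_left (π / 2)).symm
  have h2 := h0.comp_add_left (π / 2)
  rw [show π / 2 - π = -(π / 2) by ring, show π / 2 - 0 = π / 2 by ring] at h1
  rw [show π - π / 2 = π / 2 by ring, show 0 - π / 2 = -(π / 2) by ring] at h2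
  rw [intervalIntegrable_iff_integrableOn_Ioo_of_le hle] at h1 h2
  refine ((h1.add h2).const_mul ((2 / π) ^ (-(2 / 3) : ℝ))).mono' ?_ ?_
  · refine ContinuousOn.aestronglyMeasurable (fun ψ hψ => ?_) measurableSet_Ioo
    exact (Real.continuous_cos.continuousAt.rpow_const
      (Or.inl (cos_pos_of_mem hψ).ne')).continuousWithinAt
  · refine (ae_restrict_iff' measurableSet_Ioo).2 (Eventually.of_forall fun ψ hψ => ?_)
    have hc := cos_pos_of_mem hψ
    have ha : 0 < π / 2 - ψ := by linarith [hψ.2]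
    have hb : 0 < π / 2 + ψ := by linarith [hψ.1]
    rw [Real.norm_of_nonneg (by positivity)]
    simp only [Pi.add_apply]
    rw [mul_add, ← Real.mul_rpow (by positivity) ha.le, ← Real.mul_rpow (by positivity) hb.le]
    have ha' : 0 < 2 / π * (π / 2 - ψ) := by positivity
    have hb' : 0 < 2 / π * (π / 2 + ψ) := by positivity
    rcases le_total 0 ψ with h0 | h0
    · refine le_add_of_le_of_nonneg (Real.rpow_le_rpow_of_nonpos ha' ?_ (by norm_num))
        (by positivity)
      refine le_of_eq_of_le ?_ (Real.one_sub_mul_le_cos h0 hψ.2.le)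
      field_simp
    · refine le_add_of_nonneg_of_le (by positivity)
        (Real.rpow_le_rpow_of_nonpos hb' ?_ (by norm_num))
      refine le_of_eq_of_le ?_ (Real.one_add_mul_le_cos hψ.1.le h0)
      field_simp

/-- A dominating function for the turning points over bounded sets of values `(h, δ)`. -/
def turningMajorant (p q : ℕ) (μ R ψ : ℝ) : ℝ :=
  1 + 2 * R / p + (R ^ 2 / (μ ^ 2 * (p / (2 * q) : ℝ) ^ p)) ^ (1 / 3 : ℝ) *
    cos ψ ^ (-(2 / 3) : ℝ)

theorem integrableOn_turningMajorant (R : ℝ) :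
    IntegrableOn (turningMajorant p q μ R) (Ioo (-(π / 2)) (π / 2)) := by
  have hc : IntegrableOn (fun _ : ℝ => 1 + 2 * R / (p : ℝ)) (Ioo (-(π / 2)) (π / 2)) :=
    integrableOn_const (by simp)
  exact hc.add (integrableOn_cos_rpow.const_mul _)

theorem turningPoint_le_majorant (hp : 0 < p) (hq : 0 < q) (hord : 3 ≤ p + q) (hμ : μ ≠ 0)
    {R : ℝ} (hh : |h| ≤ R) (hδ : |δ| ≤ R) (hψ : ψ ∈ Ioo (-(π / 2)) (π / 2)) :
    turningPoint p q h δ |μ * cos ψ| ≤ turningMajorant p q μ R ψ := by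
  have hp' : (0 : ℝ) < p := by exact_mod_cast hp
  have hq' : (0 : ℝ) < q := by exact_mod_cast hq
  have hc := cos_pos_of_mem hψ
  have hμ' : 0 < μ ^ 2 := by positivity
  refine (turningPoint_le_bound hp hq hord (abs_mul_cos_pos hμ hψ)).trans ?_
  have hsplit : δ ^ 2 / (|μ * cos ψ| ^ 2 * (p / (2 * q) : ℝ) ^ p) =
      δ ^ 2 / (μ ^ 2 * (p / (2 * q) : ℝ) ^ p) * cos ψ ^ (-2 : ℝ) := by
    rw [sq_abs, Real.rpow_neg hc.le, Real.rpow_two]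
    field_simp
  rw [turningBound, turningMajorant, hsplit, Real.mul_rpow (by positivity) (by positivity),
    ← Real.rpow_mul hc.le, show (-2 : ℝ) * (1 / 3) = -(2 / 3) by norm_num]
  have hsq : δ ^ 2 ≤ R ^ 2 := by rw [← sq_abs]; gcongr
  gcongr

theorem aestronglyMeasurable_turningPoint (hp : 0 < p) (hq : 0 < q) (hord : 3 ≤ p + q)
    (hμ : μ ≠ 0) : AEStronglyMeasurable (fun ψ => turningPoint p q h δ |μ * cos ψ|)
      (volume.restrict (Ioo (-(π / 2)) (π / 2))) := by
  refine ContinuousOn.aestronglyMeasurable (fun ψ hψ => ?_) measurableSet_Ioo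
  refine ContinuousAt.continuousWithinAt ?_
  exact ContinuousAt.comp (f := fun ψ => (h, δ, |μ * cos ψ|))
    (continuousAt_turningPoint hp hq hord (abs_mul_cos_pos hμ hψ)) (by fun_prop)

theorem norm_turningPoint_le (hp : 0 < p) (hq : 0 < q) (hord : 3 ≤ p + q) (hμ : μ ≠ 0)
    {R : ℝ} (hh : |h| ≤ R) (hδ : |δ| ≤ R) :
    ∀ᵐ ψ ∂volume.restrict (Ioo (-(π / 2)) (π / 2)),
      ‖turningPoint p q h δ |μ * cos ψ|‖ ≤ turningMajorant p q μ R ψ := by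
  refine (ae_restrict_iff' measurableSet_Ioo).2 (Eventually.of_forall fun ψ hψ => ?_)
  rw [Real.norm_of_nonneg turningPoint_nonneg]
  exact turningPoint_le_majorant hp hq hord hμ hh hδ hψ

theorem integrableOn_turningPoint (hp : 0 < p) (hq : 0 < q) (hord : 3 ≤ p + q) (hμ : μ ≠ 0) :
    IntegrableOn (fun ψ => turningPoint p q h δ |μ * cos ψ|) (Ioo (-(π / 2)) (π / 2)) :=
  (integrableOn_turningMajorant (max |h| |δ|)).mono'
    (aestronglyMeasurable_turningPoint hp hq hord hμ)
    (norm_turningPoint_le hp hq hord hμ (le_max_left _ _) (le_max_right _ _))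

/-- The integral of `π₁ dψ₂` along the reduced orbit. -/
def orbitArea (p q : ℕ) (μ h δ : ℝ) : ℝ :=
  ∫ ψ in Ioo (-(π / 2)) (π / 2), turningPoint p q h δ |μ * cos ψ|

theorem continuous_orbitArea (hp : 0 < p) (hq : 0 < q) (hord : 3 ≤ p + q) (hμ : μ ≠ 0) :
    Continuous fun z : ℝ × ℝ => orbitArea p q μ z.1 z.2 := by
  refine continuous_iff_continuousAt.2 fun ⟨h, δ⟩ => ?_
  set R := max |h| |δ| + 1
  have h1 : |h| < R := (le_max_left _ _).trans_lt (lt_add_one _)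
  have h2 : |δ| < R := (le_max_right _ _).trans_lt (lt_add_one _)
  refine MeasureTheory.continuousAt_of_dominated (bound := turningMajorant p q μ R)
    (Eventually.of_forall fun z => aestronglyMeasurable_turningPoint hp hq hord hμ) ?_
    (integrableOn_turningMajorant R) ?_
  · have e1 : ∀ᶠ z : ℝ × ℝ in 𝓝 (h, δ), |z.1| < R :=
      (isOpen_lt (by fun_prop) continuous_const).mem_nhds h1
    have e2 : ∀ᶠ z : ℝ × ℝ in 𝓝 (h, δ), |z.2| < R :=
      (isOpen_lt (by fun_prop) continuous_const).mem_nhds h2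
    filter_upwards [e1, e2] with z hz1 hz2
    exact norm_turningPoint_le hp hq hord hμ hz1.le hz2.le
  · refine (ae_restrict_iff' measurableSet_Ioo).2 (Eventually.of_forall fun ψ hψ => ?_)
    exact ContinuousAt.comp (f := fun z : ℝ × ℝ => (z.1, z.2, |μ * cos ψ|))
      (continuousAt_turningPoint hp hq hord (abs_mul_cos_pos hμ hψ)) (by fun_prop)

theorem orbitArea_zero (hp : 0 < p) (hq : 0 < q) (hμ : μ ≠ 0) :
    orbitArea p q μ h 0 = π * max 0 (h / p) := by
  have hπ := Real.pi_pos
  rw [orbitArea, setIntegral_congr_fun (g := fun _ => max 0 (h / p)) measurableSet_Ioo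
    fun ψ hψ => turningPoint_zero hp hq (abs_mul_cos_pos hμ hψ)]
  rw [setIntegral_const, measureReal_def, Real.volume_Ioo, ENNReal.toReal_ofReal (by linarith),
    smul_eq_mul]
  ring

/-! ### The fibre and the action -/

theorem mem_angleRange_ne (hψ : ψ ∈ angleRange μ δ) : 0 < |μ * cos ψ| :=
  abs_pos.2 fun h0 => by
    have := hψ.2.2
    simp [h0] at this

theorem norm_cycle_fst {a b : ℤ} :
    ‖(cycle p q μ a b h δ ψ).1‖ ^ 2 = turningPoint p q h δ |μ * cos ψ| := by
  simp only [cycle, norm_mul, Complex.norm_exp_ofReal_mul_I, mul_one, Complex.norm_real,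
    Real.norm_eq_abs, sq_abs]
  exact Real.sq_sqrt turningPoint_nonneg

theorem norm_cycle_snd (hp : 0 < p) (hq : 0 < q) (hord : 3 ≤ p + q) {a b : ℤ}
    (hψ : 0 < |μ * cos ψ|) : ‖(cycle p q μ a b h δ ψ).2‖ ^ 2 =
      pi2 p q h (turningPoint p q h δ |μ * cos ψ|) := by
  simp only [cycle, norm_mul, Complex.norm_exp_ofReal_mul_I, mul_one, Complex.norm_real,
    Real.norm_eq_abs, sq_abs]
  exact Real.sq_sqrt (turningPoint_mem hp hq hord hψ).2.1

theorem momentum2_cycle (hp : 0 < p) (hq : 0 < q) (hord : 3 ≤ p + q) {a b : ℤ}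
    (hab : b * (p : ℤ) + a * (q : ℤ) = 1) (hψ : 0 < |μ * cos ψ|) :
    momentum2 a b (cycle p q μ a b h δ ψ) =
      (turningPoint p q h δ |μ * cos ψ| - b * h) / q := by
  have hq' : (q : ℝ) ≠ 0 := by exact_mod_cast hq.ne'
  have hab' : (b : ℝ) * p + a * q = 1 := by exact_mod_cast hab
  rw [momentum2, norm_cycle_fst, norm_cycle_snd hp hq hord hψ, pi2]
  field_simp
  linear_combination turningPoint p q h δ |μ * cos ψ| * hab'

theorem momentumMap_cycle (hp : 0 < p) (hq : 0 < q) (hord : 3 ≤ p + q) {a b : ℤ}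
    (hab : b * (p : ℤ) + a * (q : ℤ) = 1) (hδ : δ ≠ 0) (hψ : ψ ∈ angleRange μ δ) :
    momentumMap p q μ (cycle p q μ a b h δ ψ) = (h, δ) := by
  have hq' : (q : ℝ) ≠ 0 := by exact_mod_cast hq.ne'
  have hab' : (b : ℝ) * p + a * q = 1 := by exact_mod_cast hab
  have hm := mem_angleRange_ne hψ
  obtain ⟨h1, h2, h3⟩ := turningPoint_mem (h := h) (δ := δ) hp hq hord hm
  rw [momentumMap, Prod.mk.injEq]
  constructor
  · rw [quadraticPart, norm_cycle_fst, norm_cycle_snd hp hq hord hm, pi2]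
    field_simp
    ring
  · set X := turningPoint p q h δ |μ * cos ψ| with hX
    have hprod : (cycle p q μ a b h δ ψ).1 ^ q * (cycle p q μ a b h δ ψ).2 ^ p =
        (√(resProduct p q h X) : ℂ) * Complex.exp ((ψ : ℂ) * Complex.I) := by
      have e1 : √(resProduct p q h X) = √X ^ q * √(pi2 p q h X) ^ p := by
        rw [← Real.sqrt_sq (by positivity : 0 ≤ √X ^ q * √(pi2 p q h X) ^ p), mul_pow, ← pow_mul,
          ← pow_mul, mul_comm q, mul_comm p, pow_mul, pow_mul, Real.sq_sqrt h1, Real.sq_sqrt h2]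
        rfl
      have e2 : Complex.exp (((a : ℝ) * ψ : ℝ) * Complex.I) ^ q *
          Complex.exp (((b : ℝ) * ψ : ℝ) * Complex.I) ^ p =
          Complex.exp ((ψ : ℂ) * Complex.I) := by
        have hab'' : (b : ℂ) * p + a * q = 1 := by exact_mod_cast hab
        rw [← Complex.exp_nat_mul, ← Complex.exp_nat_mul, ← Complex.exp_add]
        congr 1
        push_cast
        linear_combination (ψ : ℂ) * Complex.I * hab''
      rw [e1, ← e2, cycle, orbitPi1_eq, ← hX]
      push_cast
      ring
    have hre : (Complex.exp ((ψ : ℂ) * Complex.I)).re = cos ψ := Complex.exp_ofReal_mul_I_re ψ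
    rw [resonantPart, hprod, Complex.re_ofReal_mul, hre]
    have habs := abs_eq_of_turningPoint (h := h) hp hq hord hm hδ
    rw [← hX] at habs
    have hs := hψ.2.2
    rcases hδ.lt_or_gt with hneg | hpos
    · rw [abs_of_neg hneg, abs_of_neg (by nlinarith)] at habs
      linarith
    · rw [abs_of_pos hpos, abs_of_pos (by nlinarith)] at habs
      linarith

theorem integrableOn_momentum2 (hp : 0 < p) (hq : 0 < q) (hord : 3 ≤ p + q) (hμ : μ ≠ 0)
    {a b : ℤ} (hab : b * (p : ℤ) + a * (q : ℤ) = 1) (hδ : δ ≠ 0) :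
    IntegrableOn (fun ψ => momentum2 a b (cycle p q μ a b h δ ψ)) (angleRange μ δ) := by
  rw [integrableOn_congr_fun (fun ψ hψ => momentum2_cycle hp hq hord hab (mem_angleRange_ne hψ))
    (measurableSet_angleRange hμ hδ), integrableOn_angleRange_iff hμ hδ fun m => (turningPoint p q h δ m - b * h) / q]
  exact ((integrableOn_turningPoint hp hq hord hμ).sub (integrableOn_const (by simp))).div_const _

theorem action2_eq (hp : 0 < p) (hq : 0 < q) (hord : 3 ≤ p + q) (hμ : μ ≠ 0)
    {a b : ℤ} (hab : b * (p : ℤ) + a * (q : ℤ) = 1) (hδ : δ ≠ 0) :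
    action2 p q μ a b h δ =
      SignType.sign δ * (1 / (2 * π * q)) * (orbitArea p q μ h δ - π * b * h) := by
  have hπ := Real.pi_pos
  have hq' : (q : ℝ) ≠ 0 := by exact_mod_cast hq.ne'
  rw [action2, setIntegral_congr_fun (measurableSet_angleRange hμ hδ)
    fun ψ hψ => momentum2_cycle hp hq hord hab (mem_angleRange_ne hψ),
    setIntegral_angleRange hμ hδ fun m => (turningPoint p q h δ m - b * h) / q,
    integral_div, integral_sub (integrableOn_turningPoint hp hq hord hμ)
      (integrableOn_const (by simp)), setIntegral_const, measureReal_def, Real.volume_Ioo,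
    ENNReal.toReal_ofReal (by linarith), smul_eq_mul, orbitArea]
  field_simp
  ring

/-- The resonant angle in `(0, π / 2)` (up to sign and a half turn) at the point `π₁ = x` of the
reduced orbit. -/
def orbitAngle (p q : ℕ) (μ h δ x : ℝ) : ℝ := arccos (|δ| / (|μ| * √(resProduct p q h x)))

/-- The derivative of `orbitAngle`. -/
def orbitAngleDeriv (p q : ℕ) (μ h δ x : ℝ) : ℝ :=
  |δ| / 2 * ((q : ℝ) ^ 2 / x + (p : ℝ) ^ 2 / pi2 p q h x) / √(curvePoly p q μ h δ x)

theorem curvePoly_eq :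
    curvePoly p q μ h δ x = (q : ℝ) ^ 2 * (μ ^ 2 * resProduct p q h x - δ ^ 2) := by
  rw [curvePoly, resProduct]; ring

theorem curvePoly_pos_iff (hq : 0 < q) (hx : 0 ≤ x) (hπ : 0 ≤ pi2 p q h x) :
    0 < curvePoly p q μ h δ x ↔ |δ| < |μ| * √(resProduct p q h x) := by
  have hq' : (0 : ℝ) < q := by exact_mod_cast hq
  rw [curvePoly_eq, mul_pos_iff_of_pos_left (by positivity), sub_pos,
    ← sq_lt_sq₀ (abs_nonneg δ) (by positivity), mul_pow, sq_abs, sq_abs,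
    Real.sq_sqrt (resProduct_nonneg hx hπ)]

theorem measurableSet_orbitRange : MeasurableSet (orbitRange p q μ h δ) := by
  have h1 : Continuous fun x => pi2 p q h x :=
    (continuous_pi2 (p := p) (q := q)).comp (by fun_prop : Continuous fun x : ℝ => (h, x))
  have h2 : Continuous fun x => curvePoly p q μ h δ x := by
    unfold curvePoly; fun_prop
  exact ((isOpen_lt continuous_const continuous_id).inter
    ((isOpen_lt continuous_const h1).inter (isOpen_lt continuous_const h2))).measurableSet

theorem ratio_mem (hq : 0 < q) (hδ : δ ≠ 0) (hx : x ∈ orbitRange p q μ h δ) :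
    |δ| / (|μ| * √(resProduct p q h x)) ∈ Ioo (0 : ℝ) 1 := by
  have hδ' : 0 < |δ| := abs_pos.2 hδ
  have hlt := (curvePoly_pos_iff hq hx.1.le hx.2.1.le).1 hx.2.2
  exact ⟨div_pos hδ' (hδ'.trans hlt), (div_lt_one (hδ'.trans hlt)).2 hlt⟩

theorem abs_mul_cos_orbitAngle (hq : 0 < q) (hμ : μ ≠ 0) (hδ : δ ≠ 0)
    (hx : x ∈ orbitRange p q μ h δ) :
    |μ * cos (orbitAngle p q μ h δ x)| = |δ| / √(resProduct p q h x) := by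
  have hr := ratio_mem hq hδ hx
  have hμ' : |μ| ≠ 0 := abs_ne_zero.2 hμ
  rw [orbitAngle, Real.cos_arccos (by linarith [hr.1]) hr.2.le, abs_mul, abs_of_pos hr.1]
  field_simp

theorem turningPoint_orbit (hp : 0 < p) (hq : 0 < q) (hord : 3 ≤ p + q) (hδ : δ ≠ 0)
    (hx : x ∈ orbitRange p q μ h δ) :
    turningPoint p q h δ (|δ| / √(resProduct p q h x)) = x := by
  have hg := resProduct_pos hx.1 hx.2.1
  have hδ' : 0 < |δ| := abs_pos.2 hδ
  refine turningPoint_eq hp hq hord (by positivity) hx.1.le hx.2.1.le ?_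
  field_simp

theorem hasDerivAt_resProduct (hp : 0 < p) (hq : 0 < q) (hx : 0 < x) (hπ : 0 < pi2 p q h x) :
    HasDerivAt (resProduct p q h)
      (resProduct p q h x * (q / x + (p : ℝ) ^ 2 / (q * pi2 p q h x))) x := by
  have hq' : (q : ℝ) ≠ 0 := by exact_mod_cast hq.ne'
  have h1 : HasDerivAt (fun x => pi2 p q h x) (p / q) x := by
    have := (((hasDerivAt_id x).const_mul (p : ℝ)).sub_const h).div_const (q : ℝ)
    simpa [pi2] using this
  refine ((hasDerivAt_pow q x).mul (h1.pow p)).congr_deriv ?_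
  obtain ⟨k, rfl⟩ := Nat.exists_eq_succ_of_ne_zero hp.ne'
  obtain ⟨l, rfl⟩ := Nat.exists_eq_succ_of_ne_zero hq.ne'
  simp only [resProduct, Nat.succ_eq_add_one, Nat.add_sub_cancel, Pi.pow_apply]
  push_cast at hq' ⊢
  simp only [pow_succ]
  generalize pi2 (k + 1) (l + 1) h x = y at *
  field_simp

theorem hasDerivAt_orbitAngle (hp : 0 < p) (hq : 0 < q) (hμ : μ ≠ 0) (hδ : δ ≠ 0)
    (hx : x ∈ orbitRange p q μ h δ) :
    HasDerivAt (orbitAngle p q μ h δ) (orbitAngleDeriv p q μ h δ x) x := by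
  have hq' : (0 : ℝ) < q := by exact_mod_cast hq
  have hμ' : 0 < |μ| := abs_pos.2 hμ
  have hg := resProduct_pos hx.1 hx.2.1
  have hr := ratio_mem hq hδ hx
  have hD := hasDerivAt_resProduct hp hq hx.1 hx.2.1
  have h1 : HasDerivAt (fun x => |δ| / (|μ| * √(resProduct p q h x))) _ x :=
    (hasDerivAt_const x |δ|).div ((hD.sqrt hg.ne').const_mul |μ|) (by positivity)
  have h2 := (Real.hasDerivAt_arccos (by linarith [hr.1]) hr.2.ne).comp x h1
  refine h2.congr_deriv ?_
  have hs : √(resProduct p q h x) ^ 2 = resProduct p q h x := Real.sq_sqrt hg.le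
  have hw : √(1 - (|δ| / (|μ| * √(resProduct p q h x))) ^ 2) =
      √(curvePoly p q μ h δ x) / (q * |μ| * √(resProduct p q h x)) := by
    rw [← Real.sqrt_sq (by positivity : 0 ≤ (q : ℝ) * |μ| * √(resProduct p q h x)),
      ← Real.sqrt_div hx.2.2.le]
    congr 1
    rw [curvePoly_eq, div_pow, mul_pow, mul_pow, mul_pow, hs, sq_abs, sq_abs]
    field_simp
  have hw0 : 0 < √(curvePoly p q μ h δ x) := Real.sqrt_pos.2 hx.2.2
  have hx0 := hx.1
  have hπ0 := hx.2.1
  rw [hw, orbitAngleDeriv]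
  have hs0 : 0 < √(resProduct p q h x) := Real.sqrt_pos.2 hg
  generalize √(curvePoly p q μ h δ x) = w at *
  rw [← hs]
  generalize √(resProduct p q h x) = s at *
  generalize pi2 p q h x = y at *
  rw [Real.sqrt_sq hs0.le]
  field_simp
  ring

theorem injOn_orbitAngle (hp : 0 < p) (hq : 0 < q) (hord : 3 ≤ p + q) (hμ : μ ≠ 0)
    (hδ : δ ≠ 0) : InjOn (orbitAngle p q μ h δ) (orbitRange p q μ h δ) :=
  LeftInvOn.injOn (f₁' := fun ψ => turningPoint p q h δ |μ * cos ψ|) fun x hx => by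
    simp only [abs_mul_cos_orbitAngle hq hμ hδ hx, turningPoint_orbit hp hq hord hδ hx]

theorem image_orbitAngle (hp : 0 < p) (hq : 0 < q) (hord : 3 ≤ p + q) (hμ : μ ≠ 0)
    (hδ : δ ≠ 0) : orbitAngle p q μ h δ '' orbitRange p q μ h δ = Ioo 0 (π / 2) := by
  have hπ := Real.pi_pos
  have hμ' : 0 < |μ| := abs_pos.2 hμ
  refine Subset.antisymm ?_ fun ψ hψ => ?_
  · rintro _ ⟨x, hx, rfl⟩
    have hr := ratio_mem hq hδ hx
    exact ⟨Real.arccos_pos.2 hr.2, Real.arccos_lt_pi_div_two.2 hr.1⟩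
  · have hψ' : ψ ∈ Ioo (-(π / 2)) (π / 2) := ⟨by linarith [hψ.1], hψ.2⟩
    have hc := cos_pos_of_mem hψ'
    have hm := abs_mul_cos_pos hμ hψ'
    have hmem := turningPoint_mem (h := h) (δ := δ) hp hq hord hm
    have habs := abs_eq_of_turningPoint (h := h) hp hq hord hm hδ
    set X := turningPoint p q h δ |μ * cos ψ|
    obtain ⟨h1, h2⟩ := pos_of_mem_aboveSet hp hq hδ hmem
    have hs : 0 < √(resProduct p q h X) := Real.sqrt_pos.2 (resProduct_pos h1 h2)
    rw [abs_mul, abs_of_pos hc] at habs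
    refine ⟨X, ⟨h1, h2, (curvePoly_pos_iff hq h1.le h2.le).2 ?_⟩, ?_⟩
    · have hc1 : cos ψ < 1 := by
        rw [← Real.cos_zero]
        exact Real.cos_lt_cos_of_nonneg_of_le_pi_div_two le_rfl hψ.2.le hψ.1
      rw [← habs]
      have : 0 < |μ| * √(resProduct p q h X) := by positivity
      nlinarith
    · rw [orbitAngle, ← habs]
      rw [show |μ| * cos ψ * √(resProduct p q h X) / (|μ| * √(resProduct p q h X)) = cos ψ by
        field_simp]
      exact Real.arccos_cos hψ.1.le (by linarith [hψ.2])

theorem setIntegral_Ioo_symm {f : ℝ → ℝ} (hf : ∀ x, f (-x) = f x) {c : ℝ} (hc : 0 ≤ c)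
    (hint : IntegrableOn f (Ioo (-c) c)) :
    ∫ x in Ioo (-c) c, f x = 2 * ∫ x in Ioo 0 c, f x := by
  have hneg : ∫ x in Ioo (-c) 0, f x = ∫ x in Ioo 0 c, f x := by
    rw [← integral_Ioc_eq_integral_Ioo, ← integral_Ioc_eq_integral_Ioo,
      ← intervalIntegral.integral_of_le (by linarith), ← intervalIntegral.integral_of_le hc]
    have := intervalIntegral.integral_comp_neg (a := 0) (b := c) f
    simp only [hf, neg_zero] at this
    exact this.symm
  have h1 : IntervalIntegrable f volume (-c) 0 :=
    (intervalIntegrable_iff_integrableOn_Ioo_of_le (by linarith)).2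
      (hint.mono_set (Ioo_subset_Ioo le_rfl hc))
  have h2 : IntervalIntegrable f volume 0 c :=
    (intervalIntegrable_iff_integrableOn_Ioo_of_le hc).2
      (hint.mono_set (Ioo_subset_Ioo (by linarith) le_rfl))
  have hadd := intervalIntegral.integral_add_adjacent_intervals h1 h2
  rw [intervalIntegral.integral_of_le (by linarith), intervalIntegral.integral_of_le hc,
    intervalIntegral.integral_of_le (by linarith), integral_Ioc_eq_integral_Ioo,
    integral_Ioc_eq_integral_Ioo, integral_Ioc_eq_integral_Ioo, hneg] at hadd
  linarith

theorem orbitAngleDeriv_nonneg (hx : x ∈ orbitRange p q μ h δ) :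
    0 ≤ orbitAngleDeriv p q μ h δ x := by
  have := hx.1
  have := hx.2.1
  unfold orbitAngleDeriv
  positivity

theorem orbit_substitution (hp : 0 < p) (hq : 0 < q) (hord : 3 ≤ p + q) (hμ : μ ≠ 0)
    (hδ : δ ≠ 0) {F f : ℝ → ℝ}
    (hF : IntegrableOn (fun ψ => F |μ * cos ψ|) (Ioo (-(π / 2)) (π / 2)))
    (hf : ∀ x ∈ orbitRange p q μ h δ, F (|δ| / √(resProduct p q h x)) = f x) :
    IntegrableOn (fun x => orbitAngleDeriv p q μ h δ x * f x) (orbitRange p q μ h δ) ∧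
      ∫ ψ in Ioo (-(π / 2)) (π / 2), F |μ * cos ψ| =
        2 * ∫ x in orbitRange p q μ h δ, orbitAngleDeriv p q μ h δ x * f x := by
  have hπ := Real.pi_pos
  have hd : ∀ x ∈ orbitRange p q μ h δ, HasDerivWithinAt (orbitAngle p q μ h δ)
      (orbitAngleDeriv p q μ h δ x) (orbitRange p q μ h δ) x := fun x hx =>
    (hasDerivAt_orbitAngle hp hq hμ hδ hx).hasDerivWithinAt
  have hinj := injOn_orbitAngle (h := h) hp hq hord hμ hδ
  have hcongr : ∀ x ∈ orbitRange p q μ h δ, |orbitAngleDeriv p q μ h δ x| •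
      F |μ * cos (orbitAngle p q μ h δ x)| = orbitAngleDeriv p q μ h δ x * f x := fun x hx => by
    rw [abs_of_nonneg (orbitAngleDeriv_nonneg hx), abs_mul_cos_orbitAngle hq hμ hδ hx, hf x hx,
      smul_eq_mul]
  constructor
  · have h1 := (integrableOn_image_iff_integrableOn_abs_deriv_smul measurableSet_orbitRange hd hinj
      fun ψ => F |μ * cos ψ|).1 (by
        rw [image_orbitAngle hp hq hord hμ hδ]
        exact hF.mono_set (Ioo_subset_Ioo (by linarith) le_rfl))
    exact (integrableOn_congr_fun hcongr measurableSet_orbitRange).1 h1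
  · rw [setIntegral_Ioo_symm (fun ψ => by rw [Real.cos_neg]) (by linarith) hF,
      ← image_orbitAngle (h := h) hp hq hord hμ hδ,
      integral_image_eq_integral_abs_deriv_smul measurableSet_orbitRange hd hinj,
      setIntegral_congr_fun measurableSet_orbitRange hcongr]

theorem measurable_curvePoly : Measurable fun x => curvePoly p q μ h δ x := by
  have h2 : Continuous fun x => curvePoly p q μ h δ x := by
    unfold curvePoly pi2; fun_prop
  exact h2.measurable

theorem measurable_pi2 : Measurable fun x => pi2 p q h x := by
  unfold pi2; fun_prop

/-- Along the reduced orbit `∫ dψ₂` and `∫ π₁ dψ₂` converge after the substitution by `π₁`. -/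
theorem orbit_substitution_one (hp : 0 < p) (hq : 0 < q) (hord : 3 ≤ p + q) (hμ : μ ≠ 0)
    (hδ : δ ≠ 0) :
    IntegrableOn (orbitAngleDeriv p q μ h δ) (orbitRange p q μ h δ) ∧
      π = 2 * ∫ x in orbitRange p q μ h δ, orbitAngleDeriv p q μ h δ x := by
  have hπ := Real.pi_pos
  have := orbit_substitution (h := h) (F := fun _ => 1) (f := fun _ => 1) hp hq hord hμ hδ
    (integrableOn_const (by simp)) (fun _ _ => rfl)
  simp only [mul_one, setIntegral_const, measureReal_def, Real.volume_Ioo, smul_eq_mul] at this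
  rwa [ENNReal.toReal_ofReal (by linarith), sub_neg_eq_add, add_halves] at this

theorem orbit_substitution_id (hp : 0 < p) (hq : 0 < q) (hord : 3 ≤ p + q) (hμ : μ ≠ 0)
    (hδ : δ ≠ 0) :
    IntegrableOn (fun x => orbitAngleDeriv p q μ h δ x * x) (orbitRange p q μ h δ) ∧
      orbitArea p q μ h δ =
        2 * ∫ x in orbitRange p q μ h δ, orbitAngleDeriv p q μ h δ x * x :=
  orbit_substitution (F := turningPoint p q h δ) (f := fun x => x) hp hq hord hμ hδ
    (integrableOn_turningPoint hp hq hord hμ) fun _ hx => turningPoint_orbit hp hq hord hδ hx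

theorem integrableOn_orbit_of_le {f g : ℝ → ℝ} {C : ℝ}
    (hg : IntegrableOn g (orbitRange p q μ h δ)) (hfm : Measurable f)
    (hle : ∀ x ∈ orbitRange p q μ h δ, 0 ≤ f x ∧ f x / √(curvePoly p q μ h δ x) ≤ C * g x) :
    IntegrableOn (fun x => f x / √(curvePoly p q μ h δ x)) (orbitRange p q μ h δ) := by
  refine (hg.const_mul C).mono' (hfm.div measurable_curvePoly.sqrt).aestronglyMeasurable ?_
  refine (ae_restrict_iff' measurableSet_orbitRange).2 (Eventually.of_forall fun x hx => ?_)
  have := (hle x hx).1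
  rw [Real.norm_of_nonneg (by positivity)]
  exact (hle x hx).2

theorem integrableOn_one_div_x (hp : 0 < p) (hq : 0 < q) (hord : 3 ≤ p + q) (hμ : μ ≠ 0)
    (hδ : δ ≠ 0) : IntegrableOn (fun x => 1 / x / √(curvePoly p q μ h δ x))
      (orbitRange p q μ h δ) := by
  have hq' : (0 : ℝ) < q := by exact_mod_cast hq
  have hδ' : 0 < |δ| := abs_pos.2 hδ
  refine integrableOn_orbit_of_le (C := 2 / |δ| / q ^ 2)
    (orbit_substitution_one hp hq hord hμ hδ).1 (by fun_prop) fun x hx => ?_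
  have hx0 := hx.1
  have hπ0 := hx.2.1
  have hw0 : 0 < √(curvePoly p q μ h δ x) := Real.sqrt_pos.2 hx.2.2
  refine ⟨by positivity, ?_⟩
  have h0 : 0 ≤ (p : ℝ) ^ 2 / q ^ 2 / pi2 p q h x / √(curvePoly p q μ h δ x) := by positivity
  refine (le_add_of_nonneg_right h0).trans (le_of_eq ?_)
  rw [orbitAngleDeriv]
  field_simp

theorem integrableOn_one_div_pi2 (hp : 0 < p) (hq : 0 < q) (hord : 3 ≤ p + q) (hμ : μ ≠ 0)
    (hδ : δ ≠ 0) : IntegrableOn (fun x => 1 / pi2 p q h x / √(curvePoly p q μ h δ x))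
      (orbitRange p q μ h δ) := by
  have hp' : (0 : ℝ) < p := by exact_mod_cast hp
  have hδ' : 0 < |δ| := abs_pos.2 hδ
  refine integrableOn_orbit_of_le (C := 2 / |δ| / p ^ 2)
    (orbit_substitution_one hp hq hord hμ hδ).1 (measurable_pi2.const_div 1) fun x hx => ?_
  have hx0 := hx.1
  have hπ0 := hx.2.1
  have hw0 : 0 < √(curvePoly p q μ h δ x) := Real.sqrt_pos.2 hx.2.2
  refine ⟨by positivity, ?_⟩
  have h0 : 0 ≤ (q : ℝ) ^ 2 / p ^ 2 / x / √(curvePoly p q μ h δ x) := by positivity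
  refine (le_add_of_nonneg_left h0).trans (le_of_eq ?_)
  rw [orbitAngleDeriv]
  field_simp

theorem integrableOn_one (hp : 0 < p) (hq : 0 < q) (hord : 3 ≤ p + q) (hμ : μ ≠ 0)
    (hδ : δ ≠ 0) : IntegrableOn (fun x => 1 / √(curvePoly p q μ h δ x))
      (orbitRange p q μ h δ) := by
  have hq' : (0 : ℝ) < q := by exact_mod_cast hq
  have hδ' : 0 < |δ| := abs_pos.2 hδ
  refine integrableOn_orbit_of_le (C := 2 / |δ| / q ^ 2)
    (orbit_substitution_id hp hq hord hμ hδ).1 (by fun_prop) fun x hx => ?_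
  have hx0 := hx.1
  have hπ0 := hx.2.1
  have hw0 : 0 < √(curvePoly p q μ h δ x) := Real.sqrt_pos.2 hx.2.2
  refine ⟨by positivity, ?_⟩
  have h0 : 0 ≤ (p : ℝ) ^ 2 / q ^ 2 * x / pi2 p q h x / √(curvePoly p q μ h δ x) := by positivity
  refine (le_add_of_nonneg_right h0).trans (le_of_eq ?_)
  rw [orbitAngleDeriv]
  field_simp

theorem pi_eq_orbit_integrals (hp : 0 < p) (hq : 0 < q) (hord : 3 ≤ p + q) (hμ : μ ≠ 0)
    (hδ : δ ≠ 0) : π = |δ| / 2 * ((q : ℝ) ^ 2 * orbitIntegral p q μ h δ (fun x => 1 / x) +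
      (p : ℝ) ^ 2 * orbitIntegral p q μ h δ (fun x => 1 / pi2 p q h x)) := by
  have hcongr : ∀ x ∈ orbitRange p q μ h δ, orbitAngleDeriv p q μ h δ x =
      |δ| / 2 * (q : ℝ) ^ 2 * (1 / x / √(curvePoly p q μ h δ x)) +
        |δ| / 2 * (p : ℝ) ^ 2 * (1 / pi2 p q h x / √(curvePoly p q μ h δ x)) := fun x _ => by
    rw [orbitAngleDeriv]; ring
  rw [(orbit_substitution_one (h := h) hp hq hord hμ hδ).2,
    setIntegral_congr_fun measurableSet_orbitRange hcongr,
    integral_add ((integrableOn_one_div_x hp hq hord hμ hδ).const_mul _)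
      ((integrableOn_one_div_pi2 hp hq hord hμ hδ).const_mul _),
    integral_const_mul, integral_const_mul, orbitIntegral, orbitIntegral]
  ring

theorem orbitArea_eq_orbit_integrals (hp : 0 < p) (hq : 0 < q) (hord : 3 ≤ p + q) (hμ : μ ≠ 0)
    (hδ : δ ≠ 0) : orbitArea p q μ h δ = |δ| / 2 *
      ((q : ℝ) * (p + q) * orbitIntegral p q μ h δ (fun _ => 1) +
        p * h * orbitIntegral p q μ h δ (fun x => 1 / pi2 p q h x)) := by
  have hp' : (0 : ℝ) < p := by exact_mod_cast hp
  have hq' : (0 : ℝ) < q := by exact_mod_cast hq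
  have hcongr : ∀ x ∈ orbitRange p q μ h δ, orbitAngleDeriv p q μ h δ x * x =
      |δ| / 2 * ((q : ℝ) * (p + q)) * (1 / √(curvePoly p q μ h δ x)) +
        |δ| / 2 * (p * h) * (1 / pi2 p q h x / √(curvePoly p q μ h δ x)) := fun x hx => by
    have hw0 : 0 < √(curvePoly p q μ h δ x) := Real.sqrt_pos.2 hx.2.2
    have hx0 := hx.1
    have hπ0 := hx.2.1
    have he : (p : ℝ) * x = q * pi2 p q h x + h := by rw [pi2]; field_simp; ring
    rw [orbitAngleDeriv]
    field_simp
    linear_combination (p : ℝ) * he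
  rw [(orbit_substitution_id (h := h) hp hq hord hμ hδ).2,
    setIntegral_congr_fun measurableSet_orbitRange hcongr,
    integral_add ((integrableOn_one hp hq hord hμ hδ).const_mul _)
      ((integrableOn_one_div_pi2 hp hq hord hμ hδ).const_mul _),
    integral_const_mul, integral_const_mul, orbitIntegral, orbitIntegral]
  ring

theorem action2_eq_period_rotation (hp : 0 < p) (hq : 0 < q) (hord : 3 ≤ p + q) (hμ : μ ≠ 0)
    {a b : ℤ} (hab : b * (p : ℤ) + a * (q : ℤ) = 1) (hδ : δ ≠ 0) :
    action2 p q μ a b h δ =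
      ((p : ℝ) + (q : ℝ)) / (4 * π) * δ * period p q μ h δ - h * rotation p q μ a b h δ := by
  have hπ := Real.pi_pos
  have hq' : (q : ℝ) ≠ 0 := by exact_mod_cast hq.ne'
  have hab' : (b : ℝ) * p + a * q = 1 := by exact_mod_cast hab
  have h1 := pi_eq_orbit_integrals (h := h) hp hq hord hμ hδ
  have h2 := orbitArea_eq_orbit_integrals (h := h) hp hq hord hμ hδ
  rw [action2_eq hp hq hord hμ hab hδ, rotation, rotation1, rotation2, period]
  set J0 := orbitIntegral p q μ h δ fun _ => 1
  set J1 := orbitIntegral p q μ h δ fun x => 1 / x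
  set J2 := orbitIntegral p q μ h δ fun x => 1 / pi2 p q h x
  have h3 : orbitArea p q μ h δ - π * b * h = |δ| / 2 * (q * (p + q) * J0 +
      p * h * J2 - b * h * (q ^ 2 * J1 + p ^ 2 * J2)) := by
    linear_combination h2 - b * h * h1
  have h4 : (SignType.sign δ : ℝ) * |δ| = δ := sign_mul_abs δ
  have h5 : SignType.sign δ * (1 / (2 * π * q)) * (orbitArea p q μ h δ - π * b * h) =
      δ / (4 * π * q) * (q * (p + q) * J0 +
      p * h * J2 - b * h * (q ^ 2 * J1 + p ^ 2 * J2)) := by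
    rw [h3]; nth_rewrite 3 [← h4]; field_simp; ring
  rw [h5]
  field_simp
  linear_combination -(p : ℝ) * h * J2 * hab'

/-- The coefficient of `I₁` in the sector `nπ < α < (n + 1)π`, up to a constant independent of
`n`. -/
def sectorCoeff (p q : ℕ) (b n : ℤ) : ℝ :=
  -(n : ℝ) / (2 * p * q) - (-1) ^ n * (1 / (2 * p) - b) / (2 * q)

/-- The continued action in the sector `nπ < α < (n + 1)π`, starting from sector `k`. -/
def sectorAction (p q : ℕ) (μ : ℝ) (b k n : ℤ) (x : ℝ × ℝ) : ℝ :=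
  (-1) ^ n * (1 / (2 * π * q)) *
      (orbitArea p q μ (x.1 * cos x.2) (x.1 * sin x.2) - π * b * (x.1 * cos x.2)) +
    (sectorCoeff p q b n - sectorCoeff p q b k) * (x.1 * cos x.2)

/-- The action `I₂` continued around the origin from sector `k`. -/
def continuedAction (p q : ℕ) (μ : ℝ) (b k : ℤ) (x : ℝ × ℝ) : ℝ :=
  sectorAction p q μ b k ⌊x.2 / π⌋ x

theorem floor_div_pi_of_mem {n : ℤ} {α : ℝ} (hα : α ∈ Ico ((n : ℝ) * π) (((n : ℝ) + 1) * π)) :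
    ⌊α / π⌋ = n :=
  Int.floor_eq_iff.2 ⟨(le_div_iff₀ Real.pi_pos).2 hα.1, (div_lt_iff₀ Real.pi_pos).2 hα.2⟩

theorem neg_one_zpow_mul_sin_pos {n : ℤ} {α : ℝ}
    (hα : α ∈ Ioo ((n : ℝ) * π) (((n : ℝ) + 1) * π)) : 0 < (-1) ^ n * sin α := by
  rw [← Real.sin_sub_int_mul_pi]
  exact Real.sin_pos_of_pos_of_lt_pi (by linarith [hα.1]) (by linarith [hα.2])

theorem neg_one_zpow_eq (n : ℤ) : ((-1 : ℝ) ^ n = 1) ∨ ((-1 : ℝ) ^ n = -1) := by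
  rcases Int.even_or_odd n with hn | hn
  · exact Or.inl hn.neg_one_zpow
  · exact Or.inr hn.neg_one_zpow

theorem mul_sin_ne_zero {n : ℤ} {α r : ℝ} (hr : 0 < r)
    (hα : α ∈ Ioo ((n : ℝ) * π) (((n : ℝ) + 1) * π)) : r * sin α ≠ 0 := by
  refine mul_ne_zero hr.ne' fun h0 => ?_
  have := neg_one_zpow_mul_sin_pos hα
  simp [h0] at this

theorem sign_mul_sin {n : ℤ} {α r : ℝ} (hr : 0 < r)
    (hα : α ∈ Ioo ((n : ℝ) * π) (((n : ℝ) + 1) * π)) :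
    (SignType.sign (r * sin α) : ℝ) = (-1) ^ n := by
  have h1 := neg_one_zpow_mul_sin_pos hα
  rcases neg_one_zpow_eq n with hn | hn <;> rw [hn] at h1 ⊢
  · rw [sign_pos (mul_pos hr (by linarith))]; simp
  · rw [sign_neg (mul_neg_of_pos_of_neg hr (by linarith))]; simp

theorem continuedAction_eq_action2 (hp : 0 < p) (hq : 0 < q) (hord : 3 ≤ p + q) (hμ : μ ≠ 0)
    {a b : ℤ} (hab : b * (p : ℤ) + a * (q : ℤ) = 1) (k n : ℤ) {r α : ℝ} (hr : 0 < r)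
    (hα : α ∈ Ioo ((n : ℝ) * π) (((n : ℝ) + 1) * π)) :
    continuedAction p q μ b k (r, α) = action2 p q μ a b (r * cos α) (r * sin α) +
      (sectorCoeff p q b n - sectorCoeff p q b k) * coverAction1 (r, α) := by
  rw [continuedAction, floor_div_pi_of_mem ⟨hα.1.le, hα.2⟩, sectorAction,
    action2_eq hp hq hord hμ hab (mul_sin_ne_zero hr hα), sign_mul_sin hr hα, coverAction1]

theorem continuous_sectorAction (hp : 0 < p) (hq : 0 < q) (hord : 3 ≤ p + q) (hμ : μ ≠ 0)
    (b k n : ℤ) : Continuous (sectorAction p q μ b k n) := by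
  have hA := (continuous_orbitArea hp hq hord hμ).comp
    (by fun_prop : Continuous fun x : ℝ × ℝ => (x.1 * cos x.2, x.1 * sin x.2))
  simp only [Function.comp_def] at hA
  unfold sectorAction
  fun_prop

/-- The sector functions match along the half-lines `δ = 0`. -/
theorem sectorAction_boundary (hp : 0 < p) (hq : 0 < q) (hμ : μ ≠ 0) (b k n : ℤ) {r : ℝ}
    (hr : 0 < r) :
    sectorAction p q μ b k (n - 1) (r, n * π) = sectorAction p q μ b k n (r, n * π) := by
  have hp' : (0 : ℝ) < p := by exact_mod_cast hp
  have hq' : (0 : ℝ) < q := by exact_mod_cast hq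
  have hπ := Real.pi_pos
  have hz : (-1 : ℝ) ^ (n - 1) = -(-1) ^ n := by
    rw [zpow_sub_one₀ (by norm_num)]; norm_num
  simp only [sectorAction, sectorCoeff, Real.sin_int_mul_pi, Real.cos_int_mul_pi, mul_zero,
    orbitArea_zero hp hq hμ, hz]
  push_cast
  rcases neg_one_zpow_eq n with hn | hn <;> rw [hn]
  · rw [max_eq_right (by positivity)]
    field_simp
    ring
  · rw [max_eq_left (div_nonpos_of_nonpos_of_nonneg (by linarith) hp'.le)]
    field_simp
    ring

theorem continuousAt_continuedAction (hp : 0 < p) (hq : 0 < q) (hord : 3 ≤ p + q) (hμ : μ ≠ 0)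
    (b k : ℤ) {r α : ℝ} (hr : 0 < r) : ContinuousAt (continuedAction p q μ b k) (r, α) := by
  have hπ := Real.pi_pos
  obtain ⟨n, hn⟩ : ∃ n, ⌊α / π⌋ = n := ⟨_, rfl⟩
  have h1 : (n : ℝ) * π ≤ α := hn ▸ (le_div_iff₀ hπ).1 (Int.floor_le _)
  have h2 : α < ((n : ℝ) + 1) * π := hn ▸ (div_lt_iff₀ hπ).1 (Int.lt_floor_add_one _)
  have hval : continuedAction p q μ b k (r, α) = sectorAction p q μ b k n (r, α) := by
    rw [continuedAction, hn]
  have hc := fun n => (continuous_sectorAction hp hq hord hμ b k n).tendsto (r, α)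
  rw [ContinuousAt, hval]
  have e2 : ∀ᶠ x : ℝ × ℝ in 𝓝 (r, α), x.2 < ((n : ℝ) + 1) * π :=
    (isOpen_lt (by fun_prop) continuous_const).mem_nhds h2
  rcases h1.eq_or_lt with heq | hlt
  · have e1 : ∀ᶠ x : ℝ × ℝ in 𝓝 (r, α), ((n - 1 : ℤ) : ℝ) * π < x.2 :=
      (isOpen_lt continuous_const (by fun_prop)).mem_nhds
        (show ((n - 1 : ℤ) : ℝ) * π < α by push_cast; linarith)
    intro s hs
    have hb := sectorAction_boundary hp hq hμ b k n hr
    rw [heq] at hb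
    have hs' := hs
    rw [← hb] at hs'
    rw [mem_map]
    filter_upwards [e1, e2, (hc n).eventually_mem hs, (hc (n - 1)).eventually_mem hs']
      with x hx1 hx2 hx3 hx4
    rcases lt_or_ge x.2 (n * π) with hx | hx
    · have : ⌊x.2 / π⌋ = n - 1 := floor_div_pi_of_mem ⟨hx1.le, by push_cast; linarith⟩
      rw [mem_preimage, continuedAction, this]
      exact hx4
    · rw [mem_preimage, continuedAction, floor_div_pi_of_mem ⟨hx, hx2⟩]
      exact hx3
  · have e1 : ∀ᶠ x : ℝ × ℝ in 𝓝 (r, α), (n : ℝ) * π < x.2 :=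
      (isOpen_lt continuous_const (by fun_prop)).mem_nhds hlt
    refine (hc n).congr' ?_
    filter_upwards [e1, e2] with x hx1 hx2
    rw [continuedAction, floor_div_pi_of_mem ⟨hx1.le, hx2⟩]

theorem isContinuation_continuedAction (hp : 0 < p) (hq : 0 < q) (hord : 3 ≤ p + q)
    (hμ : μ ≠ 0) {a b : ℤ} (hab : b * (p : ℤ) + a * (q : ℤ) = 1) (r₀ : ℝ) (k : ℤ) :
    IsContinuation p q μ a b r₀ k (continuedAction p q μ b k) where
  continuousOn x hx :=
    (continuousAt_continuedAction hp hq hord hμ b k (r := x.1) (α := x.2)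
      hx.1.1).continuousWithinAt
  start r hr α hα := by
    rw [continuedAction_eq_action2 hp hq hord hμ hab k k hr.1 hα, sub_self, zero_mul, add_zero]
  isAction n := ⟨sectorCoeff p q b n - sectorCoeff p q b k, 0, fun r hr α hα => by
    rw [continuedAction_eq_action2 hp hq hord hμ hab k n hr.1 hα, add_zero]⟩

/-! ### Uniqueness of the continuation -/

/-- A closed sector of the covering. -/
def closedSector (r₀ : ℝ) (n : ℤ) : Set (ℝ × ℝ) :=
  Ioo 0 r₀ ×ˢ Icc ((n : ℝ) * π) (((n : ℝ) + 1) * π)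

theorem affine_eq_on_closedSector {D : ℝ × ℝ → ℝ} {r₀ : ℝ} {n : ℤ} {c d : ℝ}
    (hD : ContinuousOn D (coverDomain r₀))
    (h : ∀ r ∈ Ioo 0 r₀, ∀ α ∈ Ioo ((n : ℝ) * π) (((n : ℝ) + 1) * π),
      D (r, α) = c * coverAction1 (r, α) + d) :
    ∀ x ∈ closedSector r₀ n, D x = c * coverAction1 x + d := by
  have hπ := Real.pi_pos
  rintro ⟨r, α⟩ ⟨hr, hα⟩
  have hne : (n : ℝ) * π ≠ ((n : ℝ) + 1) * π := by linarith
  have hc1 : Continuous fun α => D (r, α) :=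
    hD.comp_continuous (by fun_prop) fun α => ⟨hr, mem_univ _⟩
  have hc2 : Continuous fun α => c * coverAction1 (r, α) + d := by
    unfold coverAction1; fun_prop
  have := (show EqOn (fun α => D (r, α)) (fun α => c * coverAction1 (r, α) + d) _ from
    h r hr).closure hc1 hc2
  rw [closure_Ioo hne] at this
  exact this hα

theorem coeffs_eq_zero {r₀ c d : ℝ} (hr₀ : 0 < r₀) {n : ℤ}
    (h : ∀ r ∈ Ioo 0 r₀, c * coverAction1 (r, n * π) + d = 0) : c = 0 ∧ d = 0 := by
  have h1 := h (r₀ / 2) ⟨by linarith, by linarith⟩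
  have h2 := h (r₀ / 3) ⟨by linarith, by linarith⟩
  simp only [coverAction1, Real.cos_int_mul_pi] at h1 h2
  have h3 : d = 0 := by linear_combination 3 * h2 - 2 * h1
  refine ⟨?_, h3⟩
  subst h3
  have hz : (-1 : ℝ) ^ n ≠ 0 := zpow_ne_zero _ (by norm_num)
  have : c * ((r₀ / 2) * (-1 : ℝ) ^ n) = 0 := by linarith
  exact (mul_eq_zero.1 this).resolve_right (mul_ne_zero (by linarith) hz)

/-- A continuous function on the covering that vanishes in one sector and is an affine function
of `I₁` in every sector is zero. -/
theorem eq_zero_of_affine_on_sectors {D : ℝ × ℝ → ℝ} {r₀ : ℝ} (hr₀ : 0 < r₀) {k : ℤ}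
    (hD : ContinuousOn D (coverDomain r₀))
    (h0 : ∀ r ∈ Ioo 0 r₀, ∀ α ∈ Ioo ((k : ℝ) * π) (((k : ℝ) + 1) * π), D (r, α) = 0)
    (haff : ∀ n : ℤ, ∃ c d : ℝ, ∀ r ∈ Ioo 0 r₀,
      ∀ α ∈ Ioo ((n : ℝ) * π) (((n : ℝ) + 1) * π), D (r, α) = c * coverAction1 (r, α) + d) :
    ∀ x ∈ coverDomain r₀, D x = 0 := by
  have hπ := Real.pi_pos
  have hall : ∀ n : ℤ, ∀ x ∈ closedSector r₀ n, D x = 0 := by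
    intro n
    induction n using Int.inductionOn' (b := k) with
    | zero =>
      intro x hx
      have := affine_eq_on_closedSector (c := 0) (d := 0) hD (by simpa using h0) x hx
      simpa using this
    | succ n _ ih =>
      obtain ⟨c, d, hcd⟩ := haff (n + 1)
      have hcl := affine_eq_on_closedSector hD hcd
      obtain ⟨rfl, rfl⟩ := coeffs_eq_zero (c := c) (d := d) (n := n + 1) hr₀ fun r hr => by
        rw [← hcl (r, (n + 1 : ℤ) * π) ⟨hr, le_rfl, by linarith⟩]
        refine ih _ ⟨hr, ?_, ?_⟩ <;> push_cast <;> linarith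
      intro x hx
      simpa using hcl x hx
    | pred n _ ih =>
      obtain ⟨c, d, hcd⟩ := haff (n - 1)
      have hcl := affine_eq_on_closedSector hD hcd
      obtain ⟨rfl, rfl⟩ := coeffs_eq_zero (c := c) (d := d) (n := n) hr₀ fun r hr => by
        rw [← hcl (r, (n : ℤ) * π) ⟨hr, by push_cast; linarith, by push_cast; linarith⟩]
        exact ih _ ⟨hr, le_rfl, by linarith⟩
      intro x hx
      simpa using hcl x hx
  rintro ⟨r, α⟩ hx
  exact hall ⌊α / π⌋ _ ⟨hx.1, (le_div_iff₀ hπ).1 (Int.floor_le _),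
    ((div_lt_iff₀ hπ).1 (Int.lt_floor_add_one _)).le⟩

theorem IsContinuation.eqOn {a b k : ℤ} {r₀ : ℝ} (hr₀ : 0 < r₀) {I I' : ℝ × ℝ → ℝ}
    (hI : IsContinuation p q μ a b r₀ k I) (hI' : IsContinuation p q μ a b r₀ k I') :
    EqOn I' I (coverDomain r₀) := by
  intro x hx
  refine sub_eq_zero.1 (eq_zero_of_affine_on_sectors (D := fun x => I' x - I x) (k := k) hr₀
    (hI'.continuousOn.sub hI.continuousOn) (fun r hr α hα => ?_) (fun n => ?_) x hx)
  · rw [hI.start r hr α hα, hI'.start r hr α hα, sub_self]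
  · obtain ⟨c, d, h⟩ := hI.isAction n
    obtain ⟨c', d', h'⟩ := hI'.isAction n
    refine ⟨c' - c, d' - d, fun r hr α hα => ?_⟩
    rw [h r hr α hα, h' r hr α hα]
    ring

/-! ### Monodromy -/

theorem continuedAction_add_two_pi (hp : 0 < p) (hq : 0 < q) (b k : ℤ) (r α : ℝ) :
    continuedAction p q μ b k (r, α + 2 * π) =
      -(1 / ((p : ℝ) * q)) * (r * cos α) + continuedAction p q μ b k (r, α) := by
  have hp' : (0 : ℝ) < p := by exact_mod_cast hp
  have hq' : (0 : ℝ) < q := by exact_mod_cast hq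
  have hπ := Real.pi_pos
  have hfl : ⌊(α + 2 * π) / π⌋ = ⌊α / π⌋ + 2 := by
    rw [← Int.floor_add_ofNat]
    congr 1
    field_simp
  have hz : ∀ n : ℤ, (-1 : ℝ) ^ (n + 2) = (-1) ^ n := fun n => by
    rw [zpow_add₀ (by norm_num)]; norm_num
  simp only [continuedAction, hfl, sectorAction, sectorCoeff, hz, Real.cos_add_two_pi,
    Real.sin_add_two_pi]
  push_cast
  field_simp
  ring

theorem monodromyMatrix_not_integral (hord : 3 ≤ p + q) (hp : 0 < p) (hq : 0 < q) :
    ¬ ∃ N : Matrix (Fin 2) (Fin 2) ℤ, N.map (fun n : ℤ => (n : ℝ)) = monodromyMatrix p q := by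
  rintro ⟨N, hN⟩
  have hp' : (0 : ℝ) < p := by exact_mod_cast hp
  have hq' : (0 : ℝ) < q := by exact_mod_cast hq
  have h1 : ((N 1 0 : ℤ) : ℝ) = -(1 / ((p : ℝ) * q)) := by
    simpa [monodromyMatrix] using congrFun (congrFun hN 1) 0
  have h2 : ((N 1 0 : ℤ) : ℝ) * (p * q) = -1 := by
    rw [h1]; field_simp
  have h3 : N 1 0 * ((p * q : ℕ) : ℤ) = -1 := by exact_mod_cast h2
  have h4 : ((p * q : ℕ) : ℤ) ∣ 1 := ⟨-N 1 0, by linarith⟩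
  have h5 : p * q = 1 := Nat.dvd_one.1 (by exact_mod_cast h4)
  have := Nat.eq_one_of_mul_eq_one_right h5
  have := Nat.eq_one_of_mul_eq_one_left h5
  omega

end Resonance

end

theorem mainTheorem1 (p q : ℕ) (hp : 0 < p) (hq : 0 < q) (hpq : Nat.Coprime p q)
    (hord : 3 ≤ p + q) (μ : ℝ) (hμ : μ ≠ 0) (a b : ℤ)
    (hab : b * (p : ℤ) + a * (q : ℤ) = 1) :
    -- the cycle lies in the fibre, all integrals converge, and the action has the stated form
    (∀ h δ : ℝ, δ ≠ 0 →
      (∀ ψ ∈ Resonance.angleRange μ δ,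
        Resonance.momentumMap p q μ (Resonance.cycle p q μ a b h δ ψ) = (h, δ)) ∧
      IntegrableOn
        (fun ψ => Resonance.momentum2 a b (Resonance.cycle p q μ a b h δ ψ))
        (Resonance.angleRange μ δ) ∧
      IntegrableOn (fun x => 1 / √(Resonance.curvePoly p q μ h δ x))
        (Resonance.orbitRange p q μ h δ) ∧
      IntegrableOn (fun x => 1 / x / √(Resonance.curvePoly p q μ h δ x))
        (Resonance.orbitRange p q μ h δ) ∧
      IntegrableOn (fun x => 1 / Resonance.pi2 p q h x / √(Resonance.curvePoly p q μ h δ x))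
        (Resonance.orbitRange p q μ h δ) ∧
      Resonance.action2 p q μ a b h δ =
        ((p : ℝ) + (q : ℝ)) / (4 * π) * δ * Resonance.period p q μ h δ
          - h * Resonance.rotation p q μ a b h δ) ∧
    -- the action continues uniquely around the origin, with the stated monodromy
    (∀ (r₀ : ℝ), 0 < r₀ → ∀ k : ℤ, ∃ I : ℝ × ℝ → ℝ,
      Resonance.IsContinuation p q μ a b r₀ k I ∧
      (∀ I' : ℝ × ℝ → ℝ, Resonance.IsContinuation p q μ a b r₀ k I' →
        EqOn I' I (Resonance.coverDomain r₀)) ∧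
      ∀ r ∈ Ioo 0 r₀, ∀ α : ℝ,
        ![Resonance.coverAction1 (r, α + 2 * π), I (r, α + 2 * π)] =
          Matrix.mulVec (Resonance.monodromyMatrix p q)
            ![Resonance.coverAction1 (r, α), I (r, α)]) ∧
    -- the monodromy is fractional
    ¬ ∃ N : Matrix (Fin 2) (Fin 2) ℤ, N.map (fun n : ℤ => (n : ℝ)) =
        Resonance.monodromyMatrix p q := by
  refine ⟨fun h δ hδ => ⟨fun ψ hψ => Resonance.momentumMap_cycle hp hq hord hab hδ hψ,
    Resonance.integrableOn_momentum2 hp hq hord hμ hab hδ,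
    Resonance.integrableOn_one hp hq hord hμ hδ,
    Resonance.integrableOn_one_div_x hp hq hord hμ hδ,
    Resonance.integrableOn_one_div_pi2 hp hq hord hμ hδ,
    Resonance.action2_eq_period_rotation hp hq hord hμ hab hδ⟩,
    fun r₀ hr₀ k => ?_, Resonance.monodromyMatrix_not_integral hord hp hq⟩
  have hI := Resonance.isContinuation_continuedAction hp hq hord hμ hab r₀ k
  refine ⟨_, hI, fun I' hI' => hI.eqOn hr₀ hI', fun r _ α => ?_⟩
  rw [Resonance.continuedAction_add_two_pi hp hq]
  ext i
  fin_cases i <;>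
    simp [Resonance.monodromyMatrix, Resonance.coverAction1, Matrix.mulVec, dotProduct]
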